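/- Let $S$ be a countably infinite set and let $(X_n)_{n\ge 0}$ be a Markov chain on $S\cup\{\Delta\}$ with transition function $p$, where $\Delta\notin S$ is absorbing and the restriction of $p$ to $S$ is irreducible. Let $\tau_\Delta=\inf\{n\ge 1: X_n=\Delta\}$. A probability measure $\nu$ on $S$ is a quasistationary distribution (QSD) with absorption parameter $\lambda$ if $P_\nu(X_n\in\cdot\mid\tau_\Delta>n)=\nu(\cdot)$ for all $n\ge 1$ and $P_\nu(\tau_\Delta>n)=e^{-\lambda n}$ for all $n\ge 0$. Let $\lambda_{cr}=\sup\{\lambda>0: E_x[e^{\lambda\tau_\Delta}]<\infty\text{ for some }x\in S\}$. A parameter $\lambda\in(0,\lambda_{cr}]$ is in the finite MGF regime if $E_x[e^{\lambda\tau_\Delta}]<\infty$ for some $x\in S$. Fix such a $\lambda$. For $x,y\in S$ let $$G^\lambda(x,y)=\delta_x(y)+\sum_{n\ge 1}e^{\lambda n}p^n(x,y),\qquad K^\lambda(x,y)=\frac{G^\lambda(x,y)}{\sum_{z\in S}G^\lambda(x,z)}.$$ A sequence $\mathbf x=(x_n)$ in $S$ is $\lambda,\infty$-convergent if it eventually leaves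 every finite subset of $S$ and $K^\lambda(\mathbf x,y)=\lim_{n}K^\lambda(x_n,y)$ exists for every $y\in S$. Two such sequences are equivalent if their limits $K^\lambda(\mathbf x,\cdot)$ coincide; $[\mathbf x]$ is the equivalence class of $\mathbf x$, $K^\lambda([\mathbf x],\cdot)=K^\lambda(\mathbf x,\cdot)$, and the Martin boundary $\partial^\lambda M$ is the set of equivalence classes. The Martin space is the disjoint union $M^\lambda=S\cup\partial^\lambda M$ with the metric $$\rho^\lambda(a,b)=\sum_{s\in S}2^{-q_s}\Bigl(|\delta_{a,s}-\delta_{b,s}|+\frac{|K^\lambda(a,s)-K^\lambda(b,s)|}{1+|K^\lambda(a,s)-K^\lambda(b,s)|}\Bigr),$$ where $q:S\to\{1,2,\dots\}$ is any bijection (and $\delta_{a,s}=0$ for $a\in\partial^\lambda M$). Finally, let $$S^\lambda=\{[\mathbf x]\in\partial^\lambda M: K^\lambda([\mathbf x],\cdot)\text{ is a QSD with absorption parameter }\lambda\}.$$ Then $(M^\lambda,\rho^\lambda)$ is compact, and there exists a QSD with absorption parameter $\lambda$ if and only if $S^\lambda$ is nonempty. In this case, a function $\mu:S\to\mathbb R$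 is (the mass function of) a QSD with absorption parameter $\lambda$ if and only if there exists a Borel probability measure $F$ on $M^\lambda$ with $F(S^\lambda)=1$ and $$\mu(y)=\int_{M^\lambda}K^\lambda(a,y)\,dF(a)\qquad\text{for all }y\in S.$$ -/

import Mathlib

open MeasureTheory ProbabilityTheory Filter Topology
open scoped ENNReal

noncomputable section

namespace QSD

universe u

variable {S : Type u}

/-! The state space is `Option S`, the disjoint union of `S` and the absorbing state `Δ = none`.
Both `S` and `Option S` are discrete. A transition function assigns to each state the
distribution `p x` of the next state, so the transition probability is `p(x,y) = p x y`. -/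

instance instMeasurableSpaceOption : MeasurableSpace (Option S) := ⊤

/-- The transition function as a Markov kernel. -/
def transitionKernel (p : Option S → PMF (Option S)) : Kernel (Option S) (Option S) where
  toFun x := (p x).toMeasure
  measurable' := measurable_from_top

instance (p : Option S → PMF (Option S)) : IsMarkovKernel (transitionKernel p) :=
  ⟨fun x => inferInstanceAs (IsProbabilityMeasure (p x).toMeasure)⟩

/-- The law `P_ν` on trajectories of the Markov chain with transition function `p` and initial
distribution `ν`: `X 0` has law `ν` and, given the past up to time `n`, `X (n+1)` has law
`p (X n)`. The process is the coordinate process `X n ω = ω n`. -/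
def pathMeasure (p : Option S → PMF (Option S)) (ν : PMF (Option S)) :
    Measure (ℕ → Option S) :=
  Kernel.trajMeasure (X := fun _ => Option S) ν.toMeasure
    (fun n => (transitionKernel p).comap
      (fun h : (Π _ : Finset.Iic n, Option S) => h ⟨n, Finset.mem_Iic.2 le_rfl⟩)
      (measurable_pi_apply _))

/-- The absorption time `τ_Δ = inf {n ≥ 1 : X n = Δ}`, equal to `⊤` if there is no such `n`. -/
def absorptionTime (ω : ℕ → Option S) : ℕ∞ :=
  ⨅ (n : ℕ) (_ : 1 ≤ n ∧ ω n = none), (n : ℕ∞)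

/-- `exp (lam * t)` for `t ∈ {0, 1, 2, …, ∞}` and `lam > 0`, with `exp (lam * ∞) = ∞`. -/
def expTime (lam : ℝ) : ℕ∞ → ℝ≥0∞
  | ⊤ => ⊤
  | (n : ℕ) => ENNReal.ofReal (Real.exp (lam * n))

/-- The moment generating function `E_x [exp (lam * τ_Δ)]` of the absorption time. -/
def absorptionMGF (p : Option S → PMF (Option S)) (lam : ℝ) (x : S) : ℝ≥0∞ :=
  ∫⁻ ω, expTime lam (absorptionTime ω) ∂(pathMeasure p (PMF.pure (some x)))

/-- The critical absorption parameter
`sup {lam > 0 : E_x [exp (lam * τ_Δ)] < ∞ for some x ∈ S}`. -/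
def criticalParameter (p : Option S → PMF (Option S)) : EReal :=
  sSup {l : EReal | ∃ lam : ℝ, l = lam ∧ 0 < lam ∧ ∃ x : S, absorptionMGF p lam x < ⊤}

/-- `lam ∈ (0, lam_cr]` and `E_x [exp (lam * τ_Δ)] < ∞` for some `x ∈ S`. -/
def FiniteMGFRegime (p : Option S → PMF (Option S)) (lam : ℝ) : Prop :=
  0 < lam ∧ (lam : EReal) ≤ criticalParameter p ∧ ∃ x : S, absorptionMGF p lam x < ⊤

/-- The powers `pⁿ(x,y)` of the restriction of `p` to `S`. -/
def restrictedPow (p : Option S → PMF (Option S)) : ℕ → S → S → ℝ≥0∞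
  | 0, x, y => by classical exact if x = y then 1 else 0
  | n + 1, x, y => ∑' z : S, p (some x) (some z) * restrictedPow p n z y

/-- The restriction of `p` to `S` is irreducible. -/
def IsIrreducibleOn (p : Option S → PMF (Option S)) : Prop :=
  ∀ x y : S, ∃ n : ℕ, 1 ≤ n ∧ 0 < restrictedPow p n x y

/-- `ν : S → ℝ` is (the mass function of) a quasistationary distribution with absorption
parameter `lam`: it is a probability measure on `S`,
`P_ν (X n ∈ A | τ_Δ > n) = ν A` for all `n ≥ 1` and `A ⊆ S`,
and `P_ν (τ_Δ > n) = exp (-lam * n)` for all `n ≥ 0`. -/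
def IsQSD (p : Option S → PMF (Option S)) (lam : ℝ) (ν : S → ℝ) : Prop :=
  ∃ π : PMF S, (∀ y, ν y = (π y).toReal) ∧
    (∀ n : ℕ, 1 ≤ n → ∀ A : Set S,
      (ProbabilityTheory.cond (pathMeasure p (π.map some)) {ω | (n : ℕ∞) < absorptionTime ω})
        {ω | ω n ∈ some '' A} = π.toOuterMeasure A) ∧
    (∀ n : ℕ, pathMeasure p (π.map some) {ω | (n : ℕ∞) < absorptionTime ω} =
      ENNReal.ofReal (Real.exp (-lam * n)))

/-- The Green's function `G(x,y) = δ_x(y) + ∑_{n ≥ 1} (e^lam p)^n (x,y)`. -/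
def green (p : Option S → PMF (Option S)) (lam : ℝ) (x y : S) : ℝ≥0∞ :=
  ∑' n : ℕ, ENNReal.ofReal (Real.exp (lam * n)) * restrictedPow p n x y

/-- The normalized kernel `K(x,y) = G(x,y) / G(x,S)`. -/
def kernelK (p : Option S → PMF (Option S)) (lam : ℝ) (x y : S) : ℝ :=
  (green p lam x y / ∑' z, green p lam x z).toReal

/-- `lam,∞`-convergent sequences: `x n` leaves every finite subset of `S` for good, and
`K(x n, y)` converges for every `y`. -/
def ConvergentSeq (p : Option S → PMF (Option S)) (lam : ℝ) : Type u :=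
  {x : ℕ → S // Tendsto x atTop cofinite ∧
    ∀ y, ∃ L : ℝ, Tendsto (fun n => kernelK p lam (x n) y) atTop (𝓝 L)}

/-- The limit kernel `K(𝐱,y) = lim K(x n, y)` of a `lam,∞`-convergent sequence. -/
def limitKernel (p : Option S → PMF (Option S)) (lam : ℝ) (x : ConvergentSeq p lam) (y : S) : ℝ :=
  limUnder atTop (fun n => kernelK p lam (x.1 n) y)

/-- Two `lam,∞`-convergent sequences are equivalent if they have the same limit kernel. -/
def seqSetoid (p : Option S → PMF (Option S)) (lam : ℝ) : Setoid (ConvergentSeq p lam) :=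
  Setoid.ker (limitKernel p lam)

/-- The Martin boundary: equivalence classes of `lam,∞`-convergent sequences. -/
def MartinBoundary (p : Option S → PMF (Option S)) (lam : ℝ) : Type u :=
  Quotient (seqSetoid p lam)

/-- The kernel of a boundary point. -/
def boundaryKernel (p : Option S → PMF (Option S)) (lam : ℝ) (b : MartinBoundary p lam) :
    S → ℝ :=
  Quotient.lift (limitKernel p lam) (fun _ _ h => h) b

/-- The Martin space: the disjoint union of `S` and the Martin boundary. The bijection `q` onto
the positive integers only enters the metric. -/
inductive MartinSpace (p : Option S → PMF (Option S)) (lam : ℝ) (q : S ≃ ℕ+) : Type u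
  | state (x : S) : MartinSpace p lam q
  | boundary (b : MartinBoundary p lam) : MartinSpace p lam q

variable {p : Option S → PMF (Option S)} {lam : ℝ} {q : S ≃ ℕ+}

/-- The kernel `K(a,y)` for `a` in the Martin space and `y ∈ S`. -/
def martinKernel : MartinSpace p lam q → S → ℝ
  | .state x => kernelK p lam x
  | .boundary b => boundaryKernel p lam b

/-- `δ_{a,s}`, which is `0` for every boundary point `a`. -/
def martinDelta : MartinSpace p lam q → S → ℝ
  | .state x, s => by classical exact if x = s then 1 else 0
  | .boundary _, _ => 0

/-- `d(i,j) = |i - j| / (1 + |i - j|)`. -/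
def boundedDist (i j : ℝ) : ℝ := |i - j| / (1 + |i - j|)

/-- The summand of the Martin metric belonging to `s ∈ S`. -/
def martinTerm (a b : MartinSpace p lam q) (s : S) : ℝ :=
  1 / 2 ^ (q s : ℕ) *
    (|martinDelta a s - martinDelta b s| + boundedDist (martinKernel a s) (martinKernel b s))

/-- The Martin metric. -/
def martinDist (a b : MartinSpace p lam q) : ℝ := ∑' s : S, martinTerm a b s

lemma boundedDist_nonneg (i j : ℝ) : 0 ≤ boundedDist i j := by
  unfold boundedDist; positivity

lemma boundedDist_le_one (i j : ℝ) : boundedDist i j ≤ 1 := by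
  unfold boundedDist
  rw [div_le_one (by positivity)]
  linarith

lemma boundedDist_triangle (i j k : ℝ) :
    boundedDist i k ≤ boundedDist i j + boundedDist j k := by
  have key : ∀ t : ℝ, 0 ≤ t → t / (1 + t) = 1 - 1 / (1 + t) := by
    intro t ht
    field_simp
    ring
  unfold boundedDist
  have h := abs_sub_le i j k
  have ha := abs_nonneg (i - j)
  have hb := abs_nonneg (j - k)
  have hc := abs_nonneg (i - k)
  set a := |i - j|
  set b := |j - k|
  set c := |i - k|
  have h1 : c / (1 + c) ≤ (a + b) / (1 + (a + b)) := by
    rw [div_le_div_iff₀ (by positivity) (by positivity)]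
    nlinarith
  have h2 : a / (1 + (a + b)) ≤ a / (1 + a) := by
    gcongr; linarith
  have h3 : b / (1 + (a + b)) ≤ b / (1 + b) := by
    gcongr; linarith
  rw [add_div] at h1
  linarith

lemma eq_of_boundedDist_eq_zero {i j : ℝ} (h : boundedDist i j = 0) : i = j := by
  unfold boundedDist at h
  have hp : (0 : ℝ) < 1 + |i - j| := by positivity
  rcases div_eq_zero_iff.1 h with h | h
  · exact sub_eq_zero.1 (abs_eq_zero.1 h)
  · exact absurd h hp.ne'

lemma martinTerm_nonneg (a b : MartinSpace p lam q) (s : S) : 0 ≤ martinTerm a b s := by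
  have := boundedDist_nonneg (martinKernel a s) (martinKernel b s)
  unfold martinTerm
  positivity

lemma martinDelta_mem (a : MartinSpace p lam q) (s : S) :
    0 ≤ martinDelta a s ∧ martinDelta a s ≤ 1 := by
  cases a with
  | state x => simp only [martinDelta]; split_ifs <;> norm_num
  | boundary b => simp [martinDelta]

lemma martinTerm_le (a b : MartinSpace p lam q) (s : S) :
    martinTerm a b s ≤ 1 / 2 ^ (q s : ℕ) * 2 := by
  unfold martinTerm
  have h1 := boundedDist_le_one (martinKernel a s) (martinKernel b s)
  have h2 : |martinDelta a s - martinDelta b s| ≤ 1 := by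
    have ha := martinDelta_mem a s
    have hb := martinDelta_mem b s
    rw [abs_le]
    constructor <;> linarith [ha.1, ha.2, hb.1, hb.2]
  gcongr
  linarith

lemma summable_martinTerm (a b : MartinSpace p lam q) : Summable (martinTerm a b) := by
  refine Summable.of_nonneg_of_le (martinTerm_nonneg a b) (martinTerm_le a b) ?_
  refine Summable.mul_right _ ?_
  have h : Summable (fun n : ℕ => (1 : ℝ) / 2 ^ n) := by
    simpa [one_div] using summable_geometric_two
  exact h.comp_injective (i := fun s : S => (q s : ℕ))
    (fun s t hst => q.injective (PNat.coe_injective hst))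

lemma eq_of_martinDist_eq_zero {a b : MartinSpace p lam q} (h : martinDist a b = 0) : a = b := by
  have h0 : ∀ s, martinTerm a b s = 0 := by
    have hsum := (summable_martinTerm a b).hasSum
    rw [show ∑' s, martinTerm a b s = 0 from h] at hsum
    have := (hasSum_zero_iff_of_nonneg (martinTerm_nonneg a b)).1 hsum
    exact fun s => congrFun this s
  have h1 : ∀ s, martinDelta a s = martinDelta b s ∧ martinKernel a s = martinKernel b s := by
    intro s
    have hs := h0 s
    unfold martinTerm at hs
    have hd := boundedDist_nonneg (martinKernel a s) (martinKernel b s)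
    have habs := abs_nonneg (martinDelta a s - martinDelta b s)
    rcases mul_eq_zero.1 hs with hs | hs
    · exact absurd hs (by positivity)
    · exact ⟨sub_eq_zero.1 (abs_eq_zero.1 (by linarith)),
        eq_of_boundedDist_eq_zero (by linarith)⟩
  cases a with
  | state x =>
    cases b with
    | state y =>
      have := (h1 y).1
      simp only [martinDelta] at this
      by_cases hxy : x = y
      · rw [hxy]
      · simp [hxy] at this
    | boundary b =>
      have := (h1 x).1
      simp [martinDelta] at this
  | boundary a =>
    cases b with
    | state y =>
      have := (h1 y).1
      simp [martinDelta] at this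
    | boundary b =>
      congr 1
      have hk : boundaryKernel p lam a = boundaryKernel p lam b := funext fun s => (h1 s).2
      induction a using Quotient.inductionOn with | _ x =>
      induction b using Quotient.inductionOn with | _ y =>
      exact Quotient.sound hk

instance : MetricSpace (MartinSpace p lam q) where
  dist := martinDist
  dist_self a := by
    have : martinTerm a a = fun _ => 0 := by
      funext s
      simp [martinTerm, boundedDist]
    change martinDist a a = 0
    rw [martinDist, this, tsum_zero]
  dist_comm a b := by
    have : martinTerm a b = martinTerm b a := by
      funext s
      simp only [martinTerm, boundedDist]
      rw [abs_sub_comm (martinDelta a s), abs_sub_comm (martinKernel a s)]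
    change martinDist a b = martinDist b a
    rw [martinDist, martinDist, this]
  dist_triangle a b c := by
    change martinDist a c ≤ martinDist a b + martinDist b c
    unfold martinDist
    rw [← (summable_martinTerm a b).tsum_add (summable_martinTerm b c)]
    refine (summable_martinTerm a c).tsum_le_tsum (fun s => ?_)
      ((summable_martinTerm a b).add (summable_martinTerm b c))
    unfold martinTerm
    rw [← mul_add]
    have h1 := abs_sub_le (martinDelta a s) (martinDelta b s) (martinDelta c s)
    have h2 := boundedDist_triangle (martinKernel a s) (martinKernel b s) (martinKernel c s)
    exact mul_le_mul_of_nonneg_left (by linarith) (by positivity)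
  eq_of_dist_eq_zero h := eq_of_martinDist_eq_zero h

instance : MeasurableSpace (MartinSpace p lam q) := borel _

instance : BorelSpace (MartinSpace p lam q) := ⟨rfl⟩

/-- The set of boundary points whose kernel is a QSD with absorption parameter `lam`. -/
def qsdBoundary (p : Option S → PMF (Option S)) (lam : ℝ) (q : S ≃ ℕ+) :
    Set (MartinSpace p lam q) :=
  {a | ∃ b : MartinBoundary p lam, a = .boundary b ∧ IsQSD p lam (boundaryKernel p lam b)}

end QSD

end

/-! Put `R = e^lam p` on `S`. A QSD with parameter `lam` is exactly a probability row vector with `ν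
R = ν` (`isQSD_iff`), so the theorem is an integral representation of invariant vectors. The finite
MGF at one state, spread by irreducibility, makes `G(x,S)` finite for every `x`
(`tsum_green_ne_top`). Kernels of states have mass one and are excessive; in the limit every
`K(a,·)` keeps mass at most one and `K(a,·) R ≤ K(a,·)`.

To represent a QSD `ν`, fix a finite `A` and cut `ν` off by the finite potential `∑_{x ∈ A} G(x,·)`.
The minimum is excessive and dominated by a finite potential, hence is itself a potential `σ G`
(`eq_tsum_potential_of_le`), and it still equals `ν` on `A` because `G(y,y) ≥ 1`. Since `G(x,·) =
G(x,S) K(x,·)`, this is a mixture of kernels of states, of total weight between `ν(A)` and `1`. The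
Martin space is compact, so these mixtures have a limit `F` as `A` grows, and `F` represents `ν`
(`exists_measure_of_invariant`).

Where `F` lives is settled afterwards. The inequalities for mass and invariance hold for every `a`
and become equalities after integration against `F`, so they are equalities almost everywhere
(`measure_qsdBoundary_eq_one`). States are excluded, because `G(x,·) R` misses `G(x,·)` by the unit
mass at `x`. The converse is Tonelli's theorem. -/

noncomputable section

namespace QSD

/-! ### Row vectors and nonnegative matrices -/

section RowMul

variable {S : Type*}

/-- The product `ν R` of a row vector and a nonnegative matrix. -/
def rowMul (R : S → S → ℝ≥0∞) (ν : S → ℝ≥0∞) : S → ℝ≥0∞ := fun y => ∑' x, ν x * R x y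

lemma rowMul_mono (R : S → S → ℝ≥0∞) : Monotone (rowMul R) := fun _ _ h _ =>
  ENNReal.tsum_le_tsum fun x => mul_le_mul_left (h x) _

lemma rowMul_add (R : S → S → ℝ≥0∞) (ν σ : S → ℝ≥0∞) :
    rowMul R (ν + σ) = rowMul R ν + rowMul R σ := by
  funext y
  simp only [rowMul, Pi.add_apply, add_mul, ENNReal.tsum_add]

lemma rowMul_smul (R : S → S → ℝ≥0∞) (c : ℝ≥0∞) (ν : S → ℝ≥0∞) :
    rowMul R (c • ν) = c • rowMul R ν := by
  funext y
  simp only [rowMul, Pi.smul_apply, smul_eq_mul, mul_assoc, ENNReal.tsum_mul_left]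

lemma rowMul_tsum {ι : Type*} (R : S → S → ℝ≥0∞) (f : ι → S → ℝ≥0∞) :
    rowMul R (fun y => ∑' i, f i y) = fun y => ∑' i, rowMul R (f i) y := by
  funext y
  simp only [rowMul, ← ENNReal.tsum_mul_right]
  exact ENNReal.tsum_comm

lemma iterate_rowMul_mono (R : S → S → ℝ≥0∞) (n : ℕ) : Monotone ((rowMul R)^[n]) :=
  (rowMul_mono R).iterate n

lemma iterate_rowMul_smul (R : S → S → ℝ≥0∞) (n : ℕ) (c : ℝ≥0∞) (ν : S → ℝ≥0∞) :
    (rowMul R)^[n] (c • ν) = c • (rowMul R)^[n] ν := by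
  induction n with
  | zero => rfl
  | succ n ih => rw [Function.iterate_succ_apply', ih, rowMul_smul, Function.iterate_succ_apply']

lemma iterate_rowMul_tsum {ι : Type*} (R : S → S → ℝ≥0∞) (n : ℕ) (f : ι → S → ℝ≥0∞) :
    (rowMul R)^[n] (fun y => ∑' i, f i y) = fun y => ∑' i, (rowMul R)^[n] (f i) y := by
  induction n with
  | zero => rfl
  | succ n ih =>
    rw [Function.iterate_succ_apply', ih, rowMul_tsum]
    simp only [Function.iterate_succ_apply']

open Classical in
lemma eq_tsum_smul_single (ν : S → ℝ≥0∞) :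
    ν = fun y => ∑' x, (ν x • (Pi.single x 1 : S → ℝ≥0∞)) y := by
  funext y
  rw [tsum_eq_single y]
  · simp
  · intro x hx
    simp [hx.symm]

open Classical in
lemma iterate_rowMul_eq_tsum (R : S → S → ℝ≥0∞) (n : ℕ) (ν : S → ℝ≥0∞) (y : S) :
    (rowMul R)^[n] ν y = ∑' x, ν x * (rowMul R)^[n] (Pi.single x 1) y := by
  conv_lhs => rw [eq_tsum_smul_single ν, iterate_rowMul_tsum]
  simp only [iterate_rowMul_smul, Pi.smul_apply, smul_eq_mul]

open Classical in
lemma rowMul_single (R : S → S → ℝ≥0∞) (x : S) : rowMul R (Pi.single x 1) = R x := by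
  funext y
  rw [rowMul, tsum_eq_single x]
  · simp
  · intro z hz
    simp [hz]

lemma iterate_rowMul_const_mul (R : S → S → ℝ≥0∞) (c : ℝ≥0∞) (n : ℕ) (ν : S → ℝ≥0∞) :
    (rowMul (fun x y => c * R x y))^[n] ν = c ^ n • (rowMul R)^[n] ν := by
  have h1 : ∀ ν, rowMul (fun x y => c * R x y) ν = c • rowMul R ν := by
    intro ν
    funext y
    simp only [rowMul, Pi.smul_apply, smul_eq_mul, ← ENNReal.tsum_mul_left]
    exact tsum_congr fun x => by ring
  induction n with
  | zero => simp
  | succ n ih =>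
    rw [Function.iterate_succ_apply', ih, h1, rowMul_smul, smul_smul, Function.iterate_succ_apply',
      pow_succ']

open Classical in
/-- The potential kernel `∑ₙ Rⁿ`. -/
def potential (R : S → S → ℝ≥0∞) (x y : S) : ℝ≥0∞ := ∑' n, (rowMul R)^[n] (Pi.single x 1) y

lemma tsum_iterate_rowMul (R : S → S → ℝ≥0∞) (ν : S → ℝ≥0∞) (y : S) :
    ∑' n, (rowMul R)^[n] ν y = ∑' x, ν x * potential R x y := by
  classical
  simp_rw [iterate_rowMul_eq_tsum R _ ν, potential, ← ENNReal.tsum_mul_left]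
  exact ENNReal.tsum_comm

open Classical in
/-- `G = 1 + G R`. -/
lemma potential_eq_single_add (R : S → S → ℝ≥0∞) (x : S) :
    potential R x = Pi.single x 1 + rowMul R (potential R x) := by
  have h : rowMul R (potential R x) =
      fun y => ∑' n, (rowMul R)^[n + 1] (Pi.single x 1) y := by
    have : potential R x = fun y => ∑' n, (rowMul R)^[n] (Pi.single x 1) y := rfl
    rw [this, rowMul_tsum]
    simp only [Function.iterate_succ_apply']
  rw [h]
  funext y
  exact tsum_eq_zero_add' ENNReal.summable

lemma one_le_potential_self (R : S → S → ℝ≥0∞) (x : S) : 1 ≤ potential R x x := by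
  classical
  rw [potential_eq_single_add]
  simp

lemma rowMul_potential_le (R : S → S → ℝ≥0∞) (x : S) :
    rowMul R (potential R x) ≤ potential R x := by
  classical
  conv_rhs => rw [potential_eq_single_add]
  exact le_add_self

-- Visits to `z` that pass through `y` at time `n` are only some of the visits from `x`: `Rⁿ(x,y)
-- Rᵐ(y,z) ≤ Rᵐ⁺ⁿ(x,z)`. This carries finiteness of the total Green mass from `x` to any `y`
-- reachable from it.
open Classical in
lemma mul_tsum_potential_le (R : S → S → ℝ≥0∞) (n : ℕ) (x y : S) :
    (rowMul R)^[n] (Pi.single x 1) y * ∑' z, potential R y z ≤ ∑' z, potential R x z := by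
  rw [← ENNReal.tsum_mul_left]
  refine ENNReal.tsum_le_tsum fun z => ?_
  unfold potential
  rw [← ENNReal.tsum_mul_left]
  have h : (rowMul R)^[n] (Pi.single x 1) y • (Pi.single y 1 : S → ℝ≥0∞) ≤
      (rowMul R)^[n] (Pi.single x 1) := by
    intro w
    by_cases hw : w = y
    · subst hw; simp
    · simp [hw]
  calc ∑' m, (rowMul R)^[n] (Pi.single x 1) y * (rowMul R)^[m] (Pi.single y 1) z
      ≤ ∑' m, (rowMul R)^[m + n] (Pi.single x 1) z := by
        refine ENNReal.tsum_le_tsum fun m => ?_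
        have := iterate_rowMul_mono R m h z
        rwa [iterate_rowMul_smul, ← Function.iterate_add_apply] at this
    _ ≤ _ := ENNReal.tsum_comp_le_tsum_of_injective (add_left_injective n) _

/-- An excessive row vector dominated by a finite potential is a potential. -/
lemma eq_tsum_potential_of_le (R : S → S → ℝ≥0∞) {w m : S → ℝ≥0∞}
    (hw : rowMul R w ≤ w) (hm : ∀ y, ∑' x, m x * potential R x y ≠ ⊤)
    (hle : ∀ y, w y ≤ ∑' x, m x * potential R x y) (y : S) :
    w y = ∑' x, (w - rowMul R w) x * potential R x y := by
  -- The truncated subtraction loses nothing, since `w R ≤ w`; `σ` is the charge of `w`.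
  set σ := w - rowMul R w
  have hσ : w = σ + rowMul R w := by
    funext x; exact (tsub_add_cancel_of_le (hw x)).symm
  have hiter_add : ∀ n (f g : S → ℝ≥0∞),
      (rowMul R)^[n] (f + g) = (rowMul R)^[n] f + (rowMul R)^[n] g := by
    intro n
    induction n with
    | zero => intro f g; rfl
    | succ n ih => intro f g; simp only [Function.iterate_succ_apply, rowMul_add, ih]
  -- Iterating `w = σ + w R` leaves the remainder `w Rⁿ`, which is at most the tail of the
  -- convergent series `∑ₖ m Rᵏ` and so vanishes: there is no invariant part.
  have hn : ∀ n, w y = ∑ k ∈ Finset.range n, (rowMul R)^[k] σ y + (rowMul R)^[n] w y := by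
    intro n
    induction n with
    | zero => simp
    | succ n ih =>
      rw [ih, Finset.sum_range_succ, add_assoc]
      congr 1
      conv_lhs => rw [hσ, hiter_add]
      rfl
  have hu : (fun y => ∑' x, m x * potential R x y) = fun y => ∑' n, (rowMul R)^[n] m y := by
    funext y; rw [tsum_iterate_rowMul]
  have htail : Tendsto (fun n => ∑' k, (rowMul R)^[k + n] m y) atTop (𝓝 0) := by
    refine ENNReal.tendsto_sum_nat_add (fun k => (rowMul R)^[k] m y) ?_
    have := hm y
    rwa [congrFun hu y] at this
  have hzero : Tendsto (fun n => (rowMul R)^[n] w y) atTop (𝓝 0) := by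
    refine tendsto_of_tendsto_of_tendsto_of_le_of_le tendsto_const_nhds htail
      (fun _ => zero_le) fun n => ?_
    have h1 := iterate_rowMul_mono R n (show w ≤ _ from hle) y
    rw [hu, iterate_rowMul_tsum] at h1
    simpa only [← Function.iterate_add_apply, add_comm n] using h1
  rw [← tsum_iterate_rowMul]
  have hlim : Tendsto (fun n => ∑ k ∈ Finset.range n, (rowMul R)^[k] σ y + (rowMul R)^[n] w y)
      atTop (𝓝 (∑' k, (rowMul R)^[k] σ y + 0)) :=
    (ENNReal.tendsto_nat_tsum _).add hzero
  rw [add_zero] at hlim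
  refine tendsto_nhds_unique ?_ hlim
  simp_rw [← hn]
  exact tendsto_const_nhds

end RowMul

/-! ### The law of the chain -/

section Chain

variable {S : Type*}

/-- The restriction of the transition function to `S`. -/
def subKernel (p : Option S → PMF (Option S)) (x y : S) : ℝ≥0∞ := p (some x) (some y)

/-- The restricted transition function multiplied by `exp lam`. -/
def scaledKernel (p : Option S → PMF (Option S)) (lam : ℝ) (x y : S) : ℝ≥0∞ :=
  ENNReal.ofReal (Real.exp lam) * subKernel p x y

lemma ofReal_exp_mul_nat (lam : ℝ) (n : ℕ) :
    ENNReal.ofReal (Real.exp (lam * n)) = ENNReal.ofReal (Real.exp lam) ^ n := by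
  rw [← ENNReal.ofReal_pow (Real.exp_pos _).le, ← Real.exp_nat_mul, mul_comm]

open Classical in
lemma restrictedPow_eq (p : Option S → PMF (Option S)) (n : ℕ) (x y : S) :
    restrictedPow p n x y = (rowMul (subKernel p))^[n] (Pi.single x 1) y := by
  induction n generalizing x with
  | zero => simp [restrictedPow, Pi.single_apply, eq_comm]
  | succ n ih =>
    rw [restrictedPow, Function.iterate_succ_apply, rowMul_single, iterate_rowMul_eq_tsum]
    exact tsum_congr fun z => by rw [ih]; rfl

lemma green_eq_potential (p : Option S → PMF (Option S)) (lam : ℝ) :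
    green p lam = potential (scaledKernel p lam) := by
  classical
  funext x y
  refine tsum_congr fun n => ?_
  have : scaledKernel p lam = fun x y => ENNReal.ofReal (Real.exp lam) * subKernel p x y := rfl
  rw [this, iterate_rowMul_const_mul, restrictedPow_eq, ofReal_exp_mul_nat]
  rfl

/-- The infimum starts at `1`, so nothing is said about `ω 0`. Survival at time `0` has to come from
the initial law (`ae_zero_ne_none`). -/
lemma lt_absorptionTime_iff (n : ℕ) (ω : ℕ → Option S) :
    (n : ℕ∞) < absorptionTime ω ↔ ∀ k, 1 ≤ k → k ≤ n → ω k ≠ none := by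
  constructor
  · intro h k hk hkn hω
    have : absorptionTime ω ≤ (k : ℕ∞) := iInf₂_le k ⟨hk, hω⟩
    exact absurd (h.trans_le this) (by simpa using hkn)
  · intro h
    have : ((n + 1 : ℕ) : ℕ∞) ≤ absorptionTime ω := by
      refine le_iInf₂ fun k hk => ?_
      by_contra hlt
      rw [not_le, Nat.cast_lt] at hlt
      exact h k hk.1 (by omega) hk.2
    exact lt_of_lt_of_le (by exact_mod_cast Nat.lt_succ_self n) this

instance : DiscreteMeasurableSpace (Option S) := ⟨fun _ => trivial⟩

lemma measurableSet_apply_eq {ι : Type*} (k : ι) (a : Option S) :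
    MeasurableSet {ω : ι → Option S | ω k = a} :=
  measurable_pi_apply (X := fun _ : ι => Option S) k (MeasurableSet.of_discrete (s := {a}))

lemma measurableSet_lt_absorptionTime (n : ℕ) :
    MeasurableSet {ω : ℕ → Option S | (n : ℕ∞) < absorptionTime ω} := by
  simp_rw [lt_absorptionTime_iff, Set.ofPred_forall]
  refine MeasurableSet.iInter fun k => MeasurableSet.iInter fun _ => MeasurableSet.iInter fun _ => ?_
  exact (measurableSet_apply_eq k none).compl

variable (p : Option S → PMF (Option S))

instance (ν : PMF (Option S)) : IsProbabilityMeasure (pathMeasure p ν) := by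
  unfold pathMeasure; infer_instance

lemma pathMeasure_map_zero (ν : PMF (Option S)) :
    (pathMeasure p ν).map (fun ω => ω 0) = ν.toMeasure := by
  have h : (fun ω : ℕ → Option S => ω 0) =
      (fun h : (Π _ : Finset.Iic 0, Option S) => h ⟨0, Finset.mem_Iic.2 le_rfl⟩) ∘
        Preorder.frestrictLe (π := fun _ => Option S) 0 := rfl
  rw [h, ← Measure.map_map (by fun_prop) (by fun_prop), pathMeasure, Kernel.trajMeasure,
    Measure.map_comp _ _ (by fun_prop), Kernel.traj_map_frestrictLe, Kernel.partialTraj_self,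
    Measure.id_comp, Measure.map_map (by fun_prop) (by fun_prop)]
  exact Measure.map_id

/-- The Markov property. -/
lemma pathMeasure_markov (ν : PMF (Option S)) (n : ℕ)
    {B : Set (Π _ : Finset.Iic n, Option S)} (hB : MeasurableSet B) (a b : Option S) :
    pathMeasure p ν {ω | Preorder.frestrictLe (π := fun _ => Option S) n ω ∈ B ∧ ω n = a ∧
      ω (n + 1) = b} =
    pathMeasure p ν {ω | Preorder.frestrictLe (π := fun _ => Option S) n ω ∈ B ∧ ω n = a} *
      p a b := by
  -- The joint law of the past up to `n` and the next state is evaluated on the rectangle `s ×ˢ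
  -- {b}`; on `s` the present state is `a`, so the transition probability is the constant `p a b`.
  have key := Kernel.map_frestrictLe_trajMeasure_compProd_eq_map_trajMeasure
    (X := fun _ => Option S) (μ₀ := ν.toMeasure)
    (κ := fun n => (transitionKernel p).comap
      (fun h : (Π _ : Finset.Iic n, Option S) => h ⟨n, Finset.mem_Iic.2 le_rfl⟩)
      (measurable_pi_apply _)) (a := n)
  set s : Set (Π _ : Finset.Iic n, Option S) := B ∩ {h | h ⟨n, Finset.mem_Iic.2 le_rfl⟩ = a}
  have hs : MeasurableSet s := hB.inter (measurableSet_apply_eq _ a)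
  have h2 := congrArg (fun m => m (s ×ˢ {b})) key
  rw [Measure.compProd_apply_prod hs (MeasurableSet.of_discrete),
    Measure.map_apply (by fun_prop) (hs.prod MeasurableSet.of_discrete)] at h2
  have h3 : ∀ h ∈ s, ((transitionKernel p).comap
      (fun h : (Π _ : Finset.Iic n, Option S) => h ⟨n, Finset.mem_Iic.2 le_rfl⟩)
      (measurable_pi_apply _)) h {b} = p a b := by
    intro h hh
    rw [Kernel.comap_apply, hh.2]
    exact PMF.toMeasure_apply_singleton _ _ MeasurableSet.of_discrete
  rw [setLIntegral_congr_fun hs h3, setLIntegral_const, Measure.map_apply (by fun_prop) hs] at h2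
  rw [mul_comm]
  refine Eq.trans ?_ (h2.symm.trans ?_)
  · congr 1
    ext ω
    simp [s, and_assoc, Preorder.frestrictLe]
  · rfl

lemma ae_zero_ne_none (π : PMF S) : ∀ᵐ ω ∂(pathMeasure p (π.map some)), ω 0 ≠ none := by
  have h : ∀ᵐ a ∂((pathMeasure p (π.map some)).map (fun ω => ω 0)), a ≠ none := by
    rw [pathMeasure_map_zero, ae_iff]
    have : {a : Option S | ¬ a ≠ none} = {none} := by ext; simp
    rw [this, PMF.toMeasure_apply_singleton _ _ MeasurableSet.of_discrete, PMF.map_apply]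
    simp
  exact ae_of_ae_map (f := fun ω : ℕ → Option S => ω 0) (p := fun a => a ≠ none)
    (measurable_pi_apply 0).aemeasurable h

variable [Countable S]

/-- Induction on `n`: the event at time `n + 1` is split by the state `x ∈ S` at time `n`, with
survival up to `n` kept as the past event `B` in the Markov property. -/
lemma pathMeasure_alive (π : PMF S) (n : ℕ) (y : S) :
    pathMeasure p (π.map some) {ω | (∀ k ≤ n, ω k ≠ none) ∧ ω n = some y} =
      (rowMul (subKernel p))^[n] π y := by
  induction n generalizing y with
  | zero =>
    have h : {ω : ℕ → Option S | (∀ k ≤ 0, ω k ≠ none) ∧ ω 0 = some y} =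
        (fun ω => ω 0) ⁻¹' {some y} := by
      ext ω; simp +contextual
    rw [h, ← Measure.map_apply (by fun_prop) MeasurableSet.of_discrete, pathMeasure_map_zero,
      PMF.toMeasure_apply_singleton _ _ MeasurableSet.of_discrete, PMF.map_apply]
    rw [tsum_eq_single y]
    · simp
    · intro z hz
      simp [hz.symm]
  | succ n ih =>
    set B : Set (Π _ : Finset.Iic n, Option S) := {h | ∀ k, h k ≠ none}
    have hB : MeasurableSet B := by
      simp only [B, Set.ofPred_forall]
      exact MeasurableSet.iInter fun k =>
        (measurableSet_apply_eq k none).compl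
    have hBmem : ∀ ω : ℕ → Option S, Preorder.frestrictLe (π := fun _ => Option S) n ω ∈ B ↔
        ∀ k ≤ n, ω k ≠ none := by
      intro ω
      simp [B, Preorder.frestrictLe]
    have hU : {ω : ℕ → Option S | (∀ k ≤ n + 1, ω k ≠ none) ∧ ω (n + 1) = some y} =
        ⋃ x : S, {ω | Preorder.frestrictLe (π := fun _ => Option S) n ω ∈ B ∧ ω n = some x ∧
          ω (n + 1) = some y} := by
      ext ω
      simp only [Set.mem_iUnion, Set.mem_ofPred_eq, hBmem]
      constructor
      · rintro ⟨h1, h2⟩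
        obtain ⟨x, hx⟩ := Option.ne_none_iff_exists'.1 (h1 n (by omega))
        exact ⟨x, fun k hk => h1 k (by omega), hx, h2⟩
      · rintro ⟨x, h1, -, h3⟩
        refine ⟨fun k hk => ?_, h3⟩
        rcases Nat.le_succ_iff.1 hk with hk | hk
        · exact h1 k hk
        · subst hk; simp [h3]
    rw [hU, measure_iUnion, Function.iterate_succ_apply']
    · refine tsum_congr fun x => ?_
      rw [pathMeasure_markov p _ n hB, ← ih]
      simp only [hBmem]
      rfl
    · intro x x' hxx
      refine Set.disjoint_left.2 fun ω h h' => hxx ?_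
      exact Option.some_injective _ (h.2.1.symm.trans h'.2.1)
    · intro x
      have e1 : MeasurableSet {ω : ℕ → Option S |
          Preorder.frestrictLe (π := fun _ => Option S) n ω ∈ B} :=
        (Preorder.measurable_frestrictLe (X := fun _ => Option S) n) hB
      exact e1.inter ((measurableSet_apply_eq n (some x)).inter
        (measurableSet_apply_eq (n + 1) (some y)))

lemma pathMeasure_absorptionTime_inter (π : PMF S) (n : ℕ) (A : Set S) :
    pathMeasure p (π.map some)
        ({ω | (n : ℕ∞) < absorptionTime ω} ∩ {ω | ω n ∈ some '' A}) =
      ∑' y, A.indicator ((rowMul (subKernel p))^[n] π) y := by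
  have h1 : ({ω | (n : ℕ∞) < absorptionTime ω} ∩ {ω | ω n ∈ some '' A} : Set (ℕ → Option S))
      =ᵐ[pathMeasure p (π.map some)]
      ⋃ y : A, {ω | (∀ k ≤ n, ω k ≠ none) ∧ ω n = some (y : S)} := by
    filter_upwards [ae_zero_ne_none p π] with ω hω
    refine propext ?_
    change (_ ∧ _) ↔ ω ∈ ⋃ y : A, {ω | (∀ k ≤ n, ω k ≠ none) ∧ ω n = some (y : S)}
    simp only [Set.mem_ofPred_eq, lt_absorptionTime_iff, Set.mem_iUnion]
    constructor
    · rintro ⟨h, y, hy, hyn⟩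
      refine ⟨⟨y, hy⟩, fun k hk => ?_, hyn.symm⟩
      rcases Nat.eq_zero_or_pos k with rfl | hk0
      · exact hω
      · exact h k hk0 hk
    · rintro ⟨y, h, hy⟩
      exact ⟨fun k _ hk => h k hk, y, y.2, hy.symm⟩
  rw [measure_congr h1, measure_iUnion]
  · simp_rw [pathMeasure_alive]
    exact tsum_subtype A _
  · intro x x' hxx
    refine Set.disjoint_left.2 fun ω h h' => hxx ?_
    exact Subtype.ext (Option.some_injective _ (h.2.symm.trans h'.2))
  · intro x
    have e1 : MeasurableSet {ω : ℕ → Option S | ∀ k ≤ n, ω k ≠ none} := by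
      simp only [Set.ofPred_forall]
      exact MeasurableSet.iInter fun k => MeasurableSet.iInter fun _ =>
        (measurableSet_apply_eq k none).compl
    exact e1.inter (measurableSet_apply_eq n (some (x : S)))

lemma pathMeasure_absorptionTime (π : PMF S) (n : ℕ) :
    pathMeasure p (π.map some) {ω | (n : ℕ∞) < absorptionTime ω} =
      ∑' y, (rowMul (subKernel p))^[n] π y := by
  have := pathMeasure_absorptionTime_inter p π n Set.univ
  rw [Set.indicator_univ] at this
  rw [← this]
  refine measure_congr ?_
  filter_upwards [ae_zero_ne_none p π] with ω hω
  refine propext ?_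
  change _ ↔ (_ ∧ _)
  simp only [Set.mem_ofPred_eq]
  refine ⟨fun h => ⟨h, ?_⟩, fun h => h.1⟩
  have hn : ω n ≠ none := by
    rcases Nat.eq_zero_or_pos n with rfl | hn
    · exact hω
    · exact (lt_absorptionTime_iff n ω).1 h n hn le_rfl
  obtain ⟨x, hx⟩ := Option.ne_none_iff_exists'.1 hn
  exact ⟨x, trivial, hx.symm⟩

/-- Quasistationary distributions are the invariant probability vectors of `exp lam * p`. -/
lemma isQSD_iff (lam : ℝ) (ν : S → ℝ) :
    IsQSD p lam ν ↔ ∃ π : PMF S, (∀ y, ν y = (π y).toReal) ∧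
      rowMul (scaledKernel p lam) π = π := by
  have hsc : scaledKernel p lam =
    fun x y => ENNReal.ofReal (Real.exp lam) * subKernel p x y := rfl
  have hexp : ∀ t : ℝ, ENNReal.ofReal (Real.exp t) ≠ 0 := fun t => by
    simpa using Real.exp_pos t
  have hinv : ∀ n : ℕ, ENNReal.ofReal (Real.exp lam) ^ n *
      ENNReal.ofReal (Real.exp (-lam * n)) = 1 := by
    intro n
    rw [← ofReal_exp_mul_nat, ← ENNReal.ofReal_mul (Real.exp_pos _).le, ← Real.exp_add]
    simp
  refine exists_congr fun π => and_congr_right fun _ => ⟨?_, ?_⟩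
  · rintro ⟨h1, h2⟩
    funext y
    -- One time step and singletons already give invariance.
    have h := h1 1 le_rfl {y}
    rw [cond_apply (measurableSet_lt_absorptionTime 1), h2 1,
      pathMeasure_absorptionTime_inter, PMF.toOuterMeasure_apply_singleton,
      tsum_eq_single y (by intro z hz; simp [hz]), Set.indicator_of_mem (Set.mem_singleton y)] at h
    have h3 := iterate_rowMul_const_mul (subKernel p) (ENNReal.ofReal (Real.exp lam)) 1 π
    rw [← hsc, Function.iterate_one] at h3
    rw [h3, Pi.smul_apply, smul_eq_mul, ← h]
    congr 1
    exact ENNReal.eq_inv_of_mul_eq_one_left (hinv 1)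
  · intro h
    -- Undoing the scaling, the unscaled iterates shrink by exactly `e^(-lam n)`. This factor is the
    -- survival probability and cancels in the conditioning.
    have hU : ∀ n, (rowMul (subKernel p))^[n] π =
        ENNReal.ofReal (Real.exp (-lam * n)) • (π : S → ℝ≥0∞) := by
      intro n
      have h3 := iterate_rowMul_const_mul (subKernel p) (ENNReal.ofReal (Real.exp lam)) n π
      rw [← hsc, Function.iterate_fixed h] at h3
      conv_rhs => rw [h3]
      rw [smul_smul, mul_comm, hinv, one_smul]
    have hτ : ∀ n : ℕ, pathMeasure p (π.map some) {ω | (n : ℕ∞) < absorptionTime ω} =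
        ENNReal.ofReal (Real.exp (-lam * n)) := by
      intro n
      rw [pathMeasure_absorptionTime, hU]
      simp [ENNReal.tsum_mul_left, π.tsum_coe]
    refine ⟨fun n _ A => ?_, hτ⟩
    rw [cond_apply (measurableSet_lt_absorptionTime n), hτ, pathMeasure_absorptionTime_inter, hU,
      PMF.toOuterMeasure_apply]
    have : ∀ y, A.indicator (ENNReal.ofReal (Real.exp (-lam * n)) • (π : S → ℝ≥0∞)) y =
        ENNReal.ofReal (Real.exp (-lam * n)) * A.indicator π y := by
      intro y
      by_cases hy : y ∈ A <;> simp [hy]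
    simp_rw [this]
    rw [ENNReal.tsum_mul_left, ← mul_assoc, ENNReal.inv_mul_cancel (hexp _) ENNReal.ofReal_ne_top,
      one_mul]

/-! ### Finiteness of the total Green mass -/

lemma tsum_expTime_le {lam : ℝ} (hlam : 0 < lam) (t : ℕ∞) :
    ∑' n : ℕ, ENNReal.ofReal (Real.exp (lam * n)) * (if (n : ℕ∞) < t then 1 else 0) ≤
      ENNReal.ofReal (1 / (Real.exp lam - 1)) * expTime lam t := by
  have h1 : 0 < Real.exp lam - 1 := by linarith [Real.one_lt_exp_iff.2 hlam]
  induction t using ENat.recTopCoe with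
  | top =>
    have : expTime lam ⊤ = ⊤ := rfl
    rw [this, ENNReal.mul_top (by simpa using h1)]
    exact le_top
  | coe m =>
    have : expTime lam (m : ℕ∞) = ENNReal.ofReal (Real.exp (lam * m)) := rfl
    rw [this, tsum_eq_sum (s := Finset.range m) (by
      intro n hn
      rw [Finset.mem_range, not_lt] at hn
      rw [if_neg (by simpa using hn), mul_zero]),
      Finset.sum_congr rfl (g := fun n : ℕ => ENNReal.ofReal (Real.exp (lam * n))) (by
        intro n hn
        rw [Finset.mem_range] at hn
        rw [if_pos (by simpa using hn), mul_one]),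
      ← ENNReal.ofReal_sum_of_nonneg (fun _ _ => (Real.exp_pos _).le),
      ← ENNReal.ofReal_mul (by positivity)]
    refine ENNReal.ofReal_le_ofReal ?_
    have h2 : ∀ n : ℕ, Real.exp (lam * n) = Real.exp lam ^ n := fun n => by
      rw [← Real.exp_nat_mul, mul_comm]
    simp_rw [h2]
    rw [geom_sum_eq (by linarith), div_mul_eq_mul_div, one_mul]
    gcongr
    linarith

/-- Since `∑_y pⁿ(x,y) = P_x(τ_Δ > n)`, Tonelli gives `G(x,S) = E_x ∑_{n < τ_Δ} e^(lam n)`, and the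
inner sum is geometric. -/
lemma tsum_green_le {lam : ℝ} (hlam : 0 < lam) (x : S) :
    ∑' y, green p lam x y ≤
      ENNReal.ofReal (1 / (Real.exp lam - 1)) * absorptionMGF p lam x := by
  classical
  have hpure : (PMF.pure (some x) : PMF (Option S)) = (PMF.pure x).map some :=
    (PMF.pure_map _ _).symm
  have hsingle : ((PMF.pure x : PMF S) : S → ℝ≥0∞) = Pi.single x 1 := by
    funext y; simp [PMF.pure_apply, Pi.single_apply]
  unfold absorptionMGF
  rw [hpure, ← lintegral_const_mul' _ _ ENNReal.ofReal_ne_top]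
  refine le_trans (le_of_eq ?_) (lintegral_mono fun ω => tsum_expTime_le hlam (absorptionTime ω))
  rw [lintegral_tsum]
  · unfold green
    rw [ENNReal.tsum_comm]
    refine tsum_congr fun n => ?_
    rw [lintegral_const_mul' _ _ ENNReal.ofReal_ne_top, ENNReal.tsum_mul_left]
    congr 1
    have : (fun ω : ℕ → Option S => if (n : ℕ∞) < absorptionTime ω then (1 : ℝ≥0∞) else 0) =
        {ω | (n : ℕ∞) < absorptionTime ω}.indicator 1 := by
      funext ω; simp [Set.indicator_apply]
    rw [this, lintegral_indicator_one (measurableSet_lt_absorptionTime n),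
      pathMeasure_absorptionTime, hsingle]
    exact tsum_congr fun y => restrictedPow_eq p n x y
  · intro n
    refine (Measurable.const_mul ?_ _).aemeasurable
    exact Measurable.ite (measurableSet_lt_absorptionTime n) measurable_const measurable_const

lemma tsum_green_ne_top {lam : ℝ} (hirr : IsIrreducibleOn p) (h : FiniteMGFRegime p lam) (y : S) :
    ∑' z, green p lam y z ≠ ⊤ := by
  classical
  obtain ⟨hlam, -, x, hx⟩ := h
  have hfin : ∑' z, green p lam x z ≠ ⊤ :=
    ne_top_of_le_ne_top (ENNReal.mul_ne_top ENNReal.ofReal_ne_top hx.ne) (tsum_green_le p hlam x)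
  obtain ⟨n, -, hn⟩ := hirr x y
  rw [green_eq_potential] at hfin ⊢
  have hle := mul_tsum_potential_le (scaledKernel p lam) n x y
  have hsc : scaledKernel p lam =
    fun x y => ENNReal.ofReal (Real.exp lam) * subKernel p x y := rfl
  intro htop
  rw [htop, ENNReal.mul_top] at hle
  · exact hfin (top_le_iff.1 hle)
  · rw [hsc, iterate_rowMul_const_mul, Pi.smul_apply, ← restrictedPow_eq, smul_eq_mul]
    exact mul_ne_zero (pow_ne_zero _ (by simpa using Real.exp_pos lam)) hn.ne'

end Chain

/-! ### The Martin space -/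

section Martin

variable {S : Type*} {p : Option S → PMF (Option S)} {lam : ℝ} {q : S ≃ ℕ+}

lemma boundedDist_tendsto_zero {ι : Type*} {l : Filter ι} {f : ι → ℝ} {a : ℝ}
    (h : Tendsto f l (𝓝 a)) : Tendsto (fun i => boundedDist (f i) a) l (𝓝 0) := by
  have h1 : Tendsto (fun i => |f i - a|) l (𝓝 0) := by
    simpa using (h.sub_const a).abs
  refine squeeze_zero (fun i => boundedDist_nonneg _ _) (fun i => ?_) h1
  exact div_le_self (abs_nonneg _) (by linarith [abs_nonneg (f i - a)])

lemma tendsto_of_boundedDist {ι : Type*} {l : Filter ι} {f : ι → ℝ} {a : ℝ}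
    (h : Tendsto (fun i => boundedDist (f i) a) l (𝓝 0)) : Tendsto f l (𝓝 a) := by
  rw [tendsto_iff_dist_tendsto_zero]
  -- `d ↦ d / (1 - d)` inverts `t ↦ t / (1 + t)`, so the quotient is `|f i - a|`.
  have h1 : Tendsto (fun i => boundedDist (f i) a / (1 - boundedDist (f i) a)) l
      (𝓝 (0 / (1 - 0))) := h.div (h.const_sub 1) (by norm_num)
  rw [zero_div] at h1
  refine h1.congr fun i => ?_
  rw [Real.dist_eq, boundedDist]
  have : 0 ≤ |f i - a| := abs_nonneg _
  have h2 : 1 + |f i - a| ≠ 0 := by positivity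
  field_simp
  ring

lemma martinTerm_le_dist (a b : MartinSpace p lam q) (s : S) : martinTerm a b s ≤ dist a b :=
  (summable_martinTerm a b).le_tsum s fun t _ => martinTerm_nonneg a b t

/-- The metric topology is that of coordinatewise convergence: each term of the series is at most
the distance, and conversely the weights `2^(-q s)` allow dominated convergence. -/
lemma tendsto_martinSpace_iff {ι : Type*} {l : Filter ι} {f : ι → MartinSpace p lam q}
    {a : MartinSpace p lam q} :
    Tendsto f l (𝓝 a) ↔ (∀ s, Tendsto (fun i => martinDelta (f i) s) l (𝓝 (martinDelta a s))) ∧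
      ∀ s, Tendsto (fun i => martinKernel (f i) s) l (𝓝 (martinKernel a s)) := by
  rw [tendsto_iff_dist_tendsto_zero]
  constructor
  · intro h
    have hterm : ∀ s, Tendsto (fun i => |martinDelta (f i) s - martinDelta a s| +
        boundedDist (martinKernel (f i) s) (martinKernel a s)) l (𝓝 0) := by
      intro s
      have h1 : Tendsto (fun i => martinTerm (f i) a s) l (𝓝 0) :=
        squeeze_zero (fun i => martinTerm_nonneg _ _ _) (fun i => martinTerm_le_dist _ _ _) h
      have h2 := h1.const_mul ((2 : ℝ) ^ (q s : ℕ))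
      rw [mul_zero] at h2
      refine h2.congr fun i => ?_
      rw [martinTerm]
      field_simp
    refine ⟨fun s => ?_, fun s => tendsto_of_boundedDist ?_⟩
    · rw [tendsto_iff_dist_tendsto_zero]
      refine squeeze_zero (fun i => dist_nonneg) (fun i => ?_) (hterm s)
      rw [Real.dist_eq]
      linarith [boundedDist_nonneg (martinKernel (f i) s) (martinKernel a s)]
    · refine squeeze_zero (fun i => boundedDist_nonneg _ _) (fun i => ?_) (hterm s)
      linarith [abs_nonneg (martinDelta (f i) s - martinDelta a s)]
  · rintro ⟨h1, h2⟩
    have hb : Summable (fun s : S => 1 / 2 ^ (q s : ℕ) * (2 : ℝ)) := by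
      refine Summable.mul_right _ ?_
      have h : Summable (fun n : ℕ => (1 : ℝ) / 2 ^ n) := by
        simpa [one_div] using summable_geometric_two
      exact h.comp_injective (i := fun s : S => (q s : ℕ))
        (fun s t hst => q.injective (PNat.coe_injective hst))
    have key := tendsto_tsum_of_dominated_convergence (𝓕 := l)
      (f := fun i s => martinTerm (f i) a s) (g := fun _ => 0) hb ?_ ?_
    · rw [tsum_zero] at key
      exact key
    · intro s
      have h3 : Tendsto (fun i => |martinDelta (f i) s - martinDelta a s|) l (𝓝 0) := by
        simpa using ((h1 s).sub_const (martinDelta a s)).abs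
      have := (h3.add (boundedDist_tendsto_zero (h2 s))).const_mul ((1 : ℝ) / 2 ^ (q s : ℕ))
      rw [add_zero, mul_zero] at this
      exact this
    · refine Eventually.of_forall fun i s => ?_
      rw [Real.norm_of_nonneg (martinTerm_nonneg _ _ _)]
      exact martinTerm_le _ _ _

lemma continuous_martinKernel (s : S) :
    Continuous (fun a : MartinSpace p lam q => martinKernel a s) :=
  continuous_iff_continuousAt.2 fun _ => (tendsto_martinSpace_iff.1 tendsto_id).2 s

lemma tendsto_martinDelta_zero {x : ℕ → S} (hx : Tendsto x atTop cofinite) (s : S) :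
    Tendsto (fun n => martinDelta (.state (x n) : MartinSpace p lam q) s) atTop (𝓝 0) := by
  have h : ∀ᶠ n in atTop, x n ≠ s :=
    le_cofinite_iff_eventually_ne.1 hx s
  refine tendsto_const_nhds.congr' ?_
  filter_upwards [h] with n hn
  simp [martinDelta, hn]

lemma tendsto_limitKernel (x : ConvergentSeq p lam) (y : S) :
    Tendsto (fun n => kernelK p lam (x.1 n) y) atTop (𝓝 (limitKernel p lam x y)) :=
  tendsto_nhds_limUnder (x.2.2 y)

lemma tendsto_state (x : ConvergentSeq p lam) :
    Tendsto (fun n => (.state (x.1 n) : MartinSpace p lam q)) atTop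
      (𝓝 (.boundary (Quotient.mk (seqSetoid p lam) x))) :=
  tendsto_martinSpace_iff.2 ⟨tendsto_martinDelta_zero x.2.1, tendsto_limitKernel x⟩

/-- Lets closed conditions on `a` be checked on states only. -/
lemma denseRange_state : DenseRange (MartinSpace.state : S → MartinSpace p lam q) := by
  intro a
  cases a with
  | state x => exact subset_closure ⟨x, rfl⟩
  | boundary b =>
    induction b using Quotient.inductionOn with | _ x =>
    exact mem_closure_of_tendsto (tendsto_state x) (Eventually.of_forall fun n => ⟨_, rfl⟩)

lemma kernelK_nonneg (x y : S) : 0 ≤ kernelK p lam x y := ENNReal.toReal_nonneg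

lemma martinKernel_nonneg (a : MartinSpace p lam q) (y : S) : 0 ≤ martinKernel a y :=
  (denseRange_state (p := p) (lam := lam) (q := q)).induction_on
    (p := fun a => 0 ≤ martinKernel a y) a
    (isClosed_le continuous_const (continuous_martinKernel y)) fun x => kernelK_nonneg x y

lemma kernelK_le_one (x y : S) : kernelK p lam x y ≤ 1 := by
  refine ENNReal.toReal_le_of_le_ofReal zero_le_one ?_
  rw [ENNReal.ofReal_one]
  exact ENNReal.div_le_of_le_mul (by rw [one_mul]; exact ENNReal.le_tsum y)

/-- Kernels lie in the compact metrizable cube `[0,1]^S`, so some subsequence of them converges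
pointwise. If its states leave every finite set, it defines a boundary point; otherwise some state
recurs infinitely often and gives a constant subsequence. -/
lemma exists_tendsto_subseq_state [Countable S] (x : ℕ → S) :
    ∃ a : MartinSpace p lam q, ∃ φ : ℕ → ℕ, StrictMono φ ∧
      Tendsto (fun n => (.state (x (φ n)) : MartinSpace p lam q)) atTop (𝓝 a) := by
  have hc : IsCompact (Set.univ.pi fun _ : S => Set.Icc (0 : ℝ) 1) :=
    isCompact_univ_pi fun _ => isCompact_Icc
  obtain ⟨k, -, φ, hφ, hk⟩ := hc.tendsto_subseq (x := fun n => kernelK p lam (x n))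
    fun n y _ => ⟨kernelK_nonneg _ _, kernelK_le_one _ _⟩
  rw [tendsto_pi_nhds] at hk
  by_cases hcof : Tendsto (x ∘ φ) atTop cofinite
  · exact ⟨_, φ, hφ, tendsto_state (⟨x ∘ φ, hcof, fun y => ⟨k y, hk y⟩⟩ : ConvergentSeq p lam)⟩
  · have hfreq : ∃ s, ∃ᶠ n in atTop, x n = s := by
      by_contra hcon
      push Not at hcon
      have hx : Tendsto x atTop cofinite := le_cofinite_iff_eventually_ne.2 hcon
      exact hcof (hx.comp hφ.tendsto_atTop)
    obtain ⟨s, hs⟩ := hfreq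
    obtain ⟨ψ, hψ, hψs⟩ := extraction_of_frequently_atTop hs
    exact ⟨.state s, ψ, hψ, by simp only [hψs]; exact tendsto_const_nhds⟩

lemma compactSpace_martinSpace [Countable S] : CompactSpace (MartinSpace p lam q) := by
  refine ⟨IsSeqCompact.isCompact fun a _ => ?_⟩
  have hpos : ∀ n : ℕ, (0 : ℝ) < 1 / ((n : ℝ) + 1) := fun n => by positivity
  -- Each `a n` is replaced by a state within `1 / (n + 1)`, which reduces the claim to sequences of
  -- states.
  choose x hx using fun n : ℕ =>
    (denseRange_state (p := p) (lam := lam) (q := q)).exists_dist_lt (a n) (hpos n)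
  obtain ⟨b, φ, hφ, hb⟩ := exists_tendsto_subseq_state (p := p) (lam := lam) (q := q) x
  refine ⟨b, trivial, φ, hφ, ?_⟩
  refine (tendsto_iff_of_dist ?_).2 hb
  refine squeeze_zero (fun n => dist_nonneg) (fun n => (hx (φ n)).le) ?_
  exact tendsto_one_div_add_atTop_nhds_zero_nat.comp hφ.tendsto_atTop

/-! ### The Martin kernels as row vectors -/

/-- The row vector `K(a, ·)` with values in `ℝ≥0∞`. -/
def martinVec (a : MartinSpace p lam q) (y : S) : ℝ≥0∞ := ENNReal.ofReal (martinKernel a y)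

lemma continuous_martinVec (y : S) :
    Continuous (fun a : MartinSpace p lam q => martinVec a y) :=
  ENNReal.continuous_ofReal.comp (continuous_martinKernel y)

lemma measurable_martinVec (y : S) :
    Measurable (fun a : MartinSpace p lam q => martinVec a y) :=
  (continuous_martinVec y).measurable

lemma tsum_green_ne_zero (x : S) : ∑' z, green p lam x z ≠ 0 := by
  rw [green_eq_potential]
  exact (lt_of_lt_of_le one_pos ((one_le_potential_self _ x).trans (ENNReal.le_tsum x))).ne'

lemma martinVec_state (x : S) : martinVec (.state x : MartinSpace p lam q) =
    (∑' z, green p lam x z)⁻¹ • potential (scaledKernel p lam) x := by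
  funext y
  have h1 : green p lam x y / ∑' z, green p lam x z ≤ 1 :=
    ENNReal.div_le_of_le_mul (by rw [one_mul]; exact ENNReal.le_tsum y)
  rw [martinVec, martinKernel, kernelK, ENNReal.ofReal_toReal (ne_top_of_le_ne_top (by simp) h1),
    ← green_eq_potential, ENNReal.div_eq_inv_mul]
  rfl

/-- Mass can escape in the limit, so only an inequality survives. Finite partial sums are continuous
in `a`, hence their bound passes from states to the boundary; `rowMul_martinVec_le` uses the same
argument. -/
lemma tsum_martinVec_le_one (a : MartinSpace p lam q) : ∑' y, martinVec a y ≤ 1 := by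
  refine ENNReal.summable.tsum_le_of_sum_le fun A => ?_
  refine (denseRange_state (p := p) (lam := lam) (q := q)).induction_on
    (p := fun a => ∑ y ∈ A, martinVec a y ≤ 1) a
    (isClosed_le (continuous_finsetSum _ fun y _ => continuous_martinVec y) continuous_const)
    fun x => ?_
  refine (ENNReal.sum_le_tsum A).trans ?_
  rw [martinVec_state, ← green_eq_potential]
  simp only [Pi.smul_apply, smul_eq_mul, ENNReal.tsum_mul_left]
  exact ENNReal.inv_mul_le_one _

lemma scaledKernel_ne_top (x y : S) : scaledKernel p lam x y ≠ ⊤ :=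
  ENNReal.mul_ne_top ENNReal.ofReal_ne_top (PMF.apply_ne_top _ _)

lemma rowMul_martinVec_le (a : MartinSpace p lam q) :
    rowMul (scaledKernel p lam) (martinVec a) ≤ martinVec a := by
  intro y
  refine ENNReal.summable.tsum_le_of_sum_le fun A => ?_
  refine (denseRange_state (p := p) (lam := lam) (q := q)).induction_on
    (p := fun a => ∑ x ∈ A, martinVec a x * scaledKernel p lam x y ≤ martinVec a y) a
    (isClosed_le (continuous_finsetSum _ fun x _ => ?_) (continuous_martinVec y))
    fun x => ?_
  · exact (ENNReal.continuous_mul_const (scaledKernel_ne_top x y)).comp (continuous_martinVec x)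
  · refine (ENNReal.sum_le_tsum A).trans ?_
    change rowMul (scaledKernel p lam) (martinVec _) y ≤ _
    rw [martinVec_state, rowMul_smul]
    exact mul_le_mul_right (rowMul_potential_le _ _ _) _

/-- By `G = 1 + G R`, invariance would give `G(x,x) = 1 + G(x,x)`, impossible for a finite value. -/
lemma rowMul_martinVec_state_ne (x : S) (hx : ∑' z, green p lam x z ≠ ⊤) :
    rowMul (scaledKernel p lam) (martinVec (.state x : MartinSpace p lam q)) ≠
      martinVec (.state x : MartinSpace p lam q) := by
  classical
  intro h
  rw [martinVec_state, rowMul_smul] at h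
  have hG : potential (scaledKernel p lam) x x ≠ ⊤ := by
    rw [← green_eq_potential]
    exact ne_top_of_le_ne_top hx (ENNReal.le_tsum x)
  have h1 := congrFun h x
  simp only [Pi.smul_apply, smul_eq_mul] at h1
  rw [ENNReal.mul_right_inj (ENNReal.inv_ne_zero.2 hx)
    (ENNReal.inv_ne_top.2 (tsum_green_ne_zero x))] at h1
  have h2 := congrFun (potential_eq_single_add (scaledKernel p lam) x) x
  rw [Pi.add_apply, h1, Pi.single_eq_same] at h2
  exact (ENNReal.lt_add_right hG one_ne_zero).ne (by rw [add_comm]; exact h2)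

lemma isQSD_iff_ofReal [Countable S] (ν : S → ℝ) :
    IsQSD p lam ν ↔ (∀ y, 0 ≤ ν y) ∧ ∑' y, ENNReal.ofReal (ν y) = 1 ∧
      rowMul (scaledKernel p lam) (fun y => ENNReal.ofReal (ν y)) =
        fun y => ENNReal.ofReal (ν y) := by
  rw [isQSD_iff]
  constructor
  · rintro ⟨π, h1, h2⟩
    have h3 : (fun y => ENNReal.ofReal (ν y)) = π := by
      funext y
      rw [h1, ENNReal.ofReal_toReal (PMF.apply_ne_top _ _)]
    refine ⟨fun y => by rw [h1]; exact ENNReal.toReal_nonneg, ?_, ?_⟩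
    · rw [h3]; exact π.tsum_coe
    · rw [h3, h2]
  · rintro ⟨h1, h2, h3⟩
    refine ⟨⟨fun y => ENNReal.ofReal (ν y), h2 ▸ ENNReal.summable.hasSum⟩, fun y => ?_, h3⟩
    exact (ENNReal.toReal_ofReal (h1 y)).symm

/-- Invariance already rules out states, so membership becomes countably many measurable conditions
on the kernel alone. -/
lemma qsdBoundary_eq [Countable S] (hH : ∀ x, ∑' z, green p lam x z ≠ ⊤) :
    qsdBoundary p lam q = {a | ∑' y, martinVec a y = 1 ∧
      ∀ y, rowMul (scaledKernel p lam) (martinVec a) y = martinVec a y} := by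
  ext a
  constructor
  · rintro ⟨b, rfl, hb⟩
    rw [isQSD_iff_ofReal] at hb
    exact ⟨hb.2.1, congrFun hb.2.2⟩
  · rintro ⟨h1, h2⟩
    cases a with
    | state x => exact absurd (funext h2) (rowMul_martinVec_state_ne x (hH x))
    | boundary b =>
      exact ⟨b, rfl, (isQSD_iff_ofReal _).2
        ⟨martinKernel_nonneg (.boundary b : MartinSpace p lam q), h1, funext h2⟩⟩

lemma measurable_rowMul_martinVec [Countable S] (y : S) :
    Measurable fun a : MartinSpace p lam q => rowMul (scaledKernel p lam) (martinVec a) y :=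
  Measurable.tsum fun x => (measurable_martinVec x).mul_const _

lemma measurableSet_qsdBoundary [Countable S] (hH : ∀ x, ∑' z, green p lam x z ≠ ⊤) :
    MeasurableSet (qsdBoundary p lam q) := by
  rw [qsdBoundary_eq hH]
  refine MeasurableSet.inter (measurableSet_eq_fun (Measurable.tsum measurable_martinVec)
    measurable_const) (?_ : MeasurableSet {a | ∀ y, _ = _})
  rw [Set.ofPred_forall]
  exact MeasurableSet.iInter fun y =>
    measurableSet_eq_fun (measurable_rowMul_martinVec y) (measurable_martinVec y)

/-! ### Mixtures of Martin kernels -/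

lemma lintegral_martinVec [Countable S] (F : Measure (MartinSpace p lam q))
    [IsProbabilityMeasure F] (y : S) :
    ∫⁻ a, martinVec a y ∂F = ENNReal.ofReal (∫ a, martinKernel a y ∂F) := by
  have hle : ∀ a : MartinSpace p lam q, martinVec a y ≤ 1 := fun a =>
    (ENNReal.le_tsum y).trans (tsum_martinVec_le_one a)
  rw [integral_eq_lintegral_of_nonneg_ae
    (Eventually.of_forall fun a => martinKernel_nonneg a y)
    (continuous_martinKernel y).aestronglyMeasurable, ENNReal.ofReal_toReal]
  · rfl
  · refine ne_top_of_le_ne_top ENNReal.one_ne_top ((lintegral_mono hle).trans ?_)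
    simp

lemma isQSD_of_integral [Countable S] (hH : ∀ x, ∑' z, green p lam x z ≠ ⊤)
    (F : Measure (MartinSpace p lam q)) [IsProbabilityMeasure F]
    (hF : F (qsdBoundary p lam q) = 1) :
    IsQSD p lam (fun y => ∫ a, martinKernel a y ∂F) := by
  have hae : ∀ᵐ a ∂F, a ∈ qsdBoundary p lam q :=
    (mem_ae_iff_prob_eq_one (measurableSet_qsdBoundary hH)).2 hF
  rw [qsdBoundary_eq hH] at hae
  rw [isQSD_iff_ofReal]
  refine ⟨fun y => integral_nonneg fun a => martinKernel_nonneg a y, ?_, ?_⟩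
  · simp_rw [← lintegral_martinVec]
    rw [← lintegral_tsum fun y => (measurable_martinVec y).aemeasurable,
      lintegral_congr_ae (g := fun _ => 1) (hae.mono fun a ha => ha.1)]
    simp
  · funext y
    simp_rw [← lintegral_martinVec, rowMul]
    have h : ∀ x, (∫⁻ a, martinVec a x ∂F) * scaledKernel p lam x y =
        ∫⁻ a, martinVec a x * scaledKernel p lam x y ∂F :=
      fun x => (lintegral_mul_const _ (measurable_martinVec x)).symm
    refine (tsum_congr h).trans ?_
    rw [← lintegral_tsum fun x => ((measurable_martinVec x).mul_const _).aemeasurable]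
    exact lintegral_congr_ae (hae.mono fun a ha => ha.2 y)

/-- If `f ≤ g` and both have the same finite integral, then `f = g` almost everywhere. This is
applied to the mass bound and, for each of the countably many `y`, to excessiveness. -/
lemma measure_qsdBoundary_eq_one [Countable S] (hH : ∀ x, ∑' z, green p lam x z ≠ ⊤)
    (F : Measure (MartinSpace p lam q)) [IsProbabilityMeasure F]
    (hF : IsQSD p lam (fun y => ∫ a, martinKernel a y ∂F)) :
    F (qsdBoundary p lam q) = 1 := by
  rw [isQSD_iff_ofReal] at hF
  simp only [← lintegral_martinVec] at hF
  obtain ⟨-, h1, h2⟩ := hF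
  rw [← mem_ae_iff_prob_eq_one (measurableSet_qsdBoundary hH), qsdBoundary_eq hH]
  have e1 : (fun a : MartinSpace p lam q => ∑' y, martinVec a y) =ᵐ[F] fun _ => 1 := by
    refine ae_eq_of_ae_le_of_lintegral_le (Eventually.of_forall tsum_martinVec_le_one) ?_
      aemeasurable_const ?_
    · refine ne_top_of_le_ne_top ENNReal.one_ne_top
        ((lintegral_mono tsum_martinVec_le_one).trans ?_)
      simp
    · rw [lintegral_tsum fun y => (measurable_martinVec y).aemeasurable, h1]
      simp
  have e2 : ∀ y, (fun a : MartinSpace p lam q => rowMul (scaledKernel p lam) (martinVec a) y)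
      =ᵐ[F] fun a => martinVec a y := by
    intro y
    have h3 : ∫⁻ a, rowMul (scaledKernel p lam) (martinVec a) y ∂F = ∫⁻ a, martinVec a y ∂F := by
      rw [← congrFun h2 y]
      simp_rw [rowMul]
      rw [lintegral_tsum fun x => ((measurable_martinVec x).mul_const _).aemeasurable]
      exact tsum_congr fun x => lintegral_mul_const _ (measurable_martinVec x)
    refine ae_eq_of_ae_le_of_lintegral_le
      (Eventually.of_forall fun a => rowMul_martinVec_le a y) ?_
      (measurable_martinVec y).aemeasurable h3.ge
    rw [h3, lintegral_martinVec]
    exact ENNReal.ofReal_ne_top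
  filter_upwards [e1, ae_all_iff.2 e2] with a ha1 ha2
  exact ⟨ha1, ha2⟩

end Martin

/-! ### The integral representation -/

section Representation

variable {S : Type*} {p : Option S → PMF (Option S)} {lam : ℝ} {q : S ≃ ℕ+}

/-- An excessive vector `ν` is, on a prescribed finite set, a mixture of Green's functions of
states. -/
lemma exists_potential_le (R : S → S → ℝ≥0∞) (hR : ∀ x y, potential R x y ≠ ⊤) {ν : S → ℝ≥0∞}
    (hν : rowMul R ν ≤ ν) (hν1 : ∀ y, ν y ≤ 1) (A : Finset S) :
    ∃ σ : S → ℝ≥0∞, (∀ y, ∑' x, σ x * potential R x y ≤ ν y) ∧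
      ∀ y ∈ A, ∑' x, σ x * potential R x y = ν y := by
  classical
  -- With the indicator of `A` as charge, `u = ∑_{x ∈ A} G(x,·)` is finite everywhere, and on `A` it
  -- satisfies `u y ≥ G(y,y) ≥ 1 ≥ ν y`, so cutting off by `u` leaves `ν` unchanged there.
  set m : S → ℝ≥0∞ := fun x => if x ∈ A then 1 else 0
  set u : S → ℝ≥0∞ := fun y => ∑' x, m x * potential R x y
  have hu : ∀ y, u y = ∑ x ∈ A, potential R x y := by
    intro y
    have : u y = ∑ x ∈ A, m x * potential R x y :=
      tsum_eq_sum fun x hx => by simp [m, hx]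
    rw [this]
    exact Finset.sum_congr rfl fun x hx => by simp [m, hx]
  have huR : rowMul R u ≤ u := by
    have h1 : u = fun y => ∑' x, (m x • potential R x) y := rfl
    rw [h1, rowMul_tsum]
    intro y
    refine ENNReal.tsum_le_tsum fun x => ?_
    rw [rowMul_smul]
    exact mul_le_mul_right (rowMul_potential_le R x y) _
  have hufin : ∀ y, u y ≠ ⊤ := by
    intro y
    rw [hu]
    exact ENNReal.sum_ne_top.2 fun x _ => hR x y
  have hw : rowMul R (ν ⊓ u) ≤ ν ⊓ u :=
    le_inf ((rowMul_mono R inf_le_left).trans hν) ((rowMul_mono R inf_le_right).trans huR)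
  have hrep := eq_tsum_potential_of_le R hw hufin fun y => inf_le_right
  refine ⟨ν ⊓ u - rowMul R (ν ⊓ u), fun y => ?_, fun y hy => ?_⟩
  · rw [← hrep]
    exact inf_le_left
  · rw [← hrep, Pi.inf_apply, inf_eq_left, hu]
    exact (hν1 y).trans ((one_le_potential_self R y).trans
      (Finset.single_le_sum (f := fun x => potential R x y) (fun _ _ => zero_le) hy))

lemma exists_probabilityMeasure_approx (hH : ∀ x, ∑' z, green p lam x z ≠ ⊤) [Nonempty S]
    {ν : S → ℝ≥0∞} (hν : rowMul (scaledKernel p lam) ν = ν) (hν1 : ∑' y, ν y = 1)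
    (A : Finset S) :
    ∃ F : ProbabilityMeasure (MartinSpace p lam q), ∀ y ∈ A,
      ν y ≤ ∫⁻ a, martinVec a y ∂(F : Measure (MartinSpace p lam q)) ∧
      ∫⁻ a, martinVec a y ∂(F : Measure (MartinSpace p lam q)) ≤ ν y + (1 - ∑ z ∈ A, ν z) := by
  have hfin : ∀ x y, potential (scaledKernel p lam) x y ≠ ⊤ := by
    intro x y
    rw [← green_eq_potential]
    exact ne_top_of_le_ne_top (hH x) (ENNReal.le_tsum y)
  obtain ⟨σ, hσ, hσA⟩ := exists_potential_le (scaledKernel p lam) hfin hν.le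
    (fun y => hν1 ▸ ENNReal.le_tsum y) A
  obtain ⟨x₀⟩ := ‹Nonempty S›
  set H : S → ℝ≥0∞ := fun x => ∑' z, green p lam x z
  set W : ℝ≥0∞ := ∑' x, σ x * H x
  have hW : W = ∑' y, ∑' x, σ x * potential (scaledKernel p lam) x y := by
    rw [ENNReal.tsum_comm]
    refine tsum_congr fun x => ?_
    rw [ENNReal.tsum_mul_left, ← green_eq_potential]
  have hW1 : W ≤ 1 := by
    rw [hW, ← hν1]
    exact ENNReal.tsum_le_tsum hσ
  have hWA : ∑ z ∈ A, ν z ≤ W := by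
    rw [hW, ← Finset.sum_congr rfl hσA]
    exact ENNReal.sum_le_tsum A
  -- The weight `σ x * H x` turns the normalized kernel back into `σ x * G(x,·)`. The missing mass
  -- `1 - W ≤ 1 - ν(A)` is put on an arbitrary state, which accounts for the error in the upper
  -- bound.
  set F : Measure (MartinSpace p lam q) :=
    Measure.sum (fun x => (σ x * H x) • Measure.dirac (.state x)) +
      (1 - W) • Measure.dirac (.state x₀) with hFdef
  have hFint : ∀ y, ∫⁻ a, martinVec a y ∂F = ∑' x, σ x * potential (scaledKernel p lam) x y +
      (1 - W) * martinVec (.state x₀ : MartinSpace p lam q) y := by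
    intro y
    rw [hFdef, lintegral_add_measure, lintegral_sum_measure, lintegral_smul_measure,
      lintegral_dirac]
    congr 1
    refine tsum_congr fun x => ?_
    rw [lintegral_smul_measure, lintegral_dirac, martinVec_state, Pi.smul_apply, smul_eq_mul,
      smul_eq_mul, mul_assoc, ← mul_assoc (H x), ENNReal.mul_inv_cancel (tsum_green_ne_zero x) (hH x),
      one_mul]
  have hFprob : IsProbabilityMeasure F := by
    refine ⟨?_⟩
    rw [hFdef, Measure.add_apply, Measure.sum_apply _ MeasurableSet.univ]
    simp only [Measure.smul_apply, measure_univ, smul_eq_mul, mul_one]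
    exact add_tsub_cancel_of_le hW1
  refine ⟨⟨F, hFprob⟩, fun y hy => ?_⟩
  change ν y ≤ ∫⁻ a, martinVec a y ∂F ∧ ∫⁻ a, martinVec a y ∂F ≤ _
  rw [hFint, hσA y hy]
  refine ⟨le_self_add, add_le_add_right ?_ _⟩
  calc (1 - W) * martinVec (.state x₀ : MartinSpace p lam q) y ≤ (1 - W) * 1 :=
        mul_le_mul_right ((ENNReal.le_tsum y).trans (tsum_martinVec_le_one _)) _
    _ ≤ 1 - ∑ z ∈ A, ν z := by rw [mul_one]; exact tsub_le_tsub_left hWA _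

lemma exists_measure_of_invariant [Countable S] [Nonempty S]
    (hH : ∀ x, ∑' z, green p lam x z ≠ ⊤)
    {ν : S → ℝ≥0∞} (hν : rowMul (scaledKernel p lam) ν = ν) (hν1 : ∑' y, ν y = 1) :
    ∃ F : ProbabilityMeasure (MartinSpace p lam q), ∀ y,
      ∫ a, martinKernel a y ∂(F : Measure (MartinSpace p lam q)) = (ν y).toReal := by
  have : CompactSpace (MartinSpace p lam q) := compactSpace_martinSpace
  choose F hF using exists_probabilityMeasure_approx (q := q) hH hν hν1
  -- Probability measures on a compact metric space form a compact space. An ultrafilter finer than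
  -- `atTop` on finite subsets of `S` selects a limit without passing to a sequence.
  obtain ⟨F₀, -, hF₀⟩ := isCompact_univ (X := ProbabilityMeasure (MartinSpace p lam q))
    |>.ultrafilter_le_nhds ((Ultrafilter.of atTop).map F) (by simp)
  have hlim : Tendsto F ((Ultrafilter.of atTop : Ultrafilter (Finset S)) : Filter (Finset S)) (𝓝 F₀) := hF₀
  refine ⟨F₀, fun y => ?_⟩
  have h1 := ProbabilityMeasure.tendsto_iff_forall_integral_tendsto.1 hlim
    (BoundedContinuousFunction.mkOfCompact ⟨_, continuous_martinKernel y⟩)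
  simp only [BoundedContinuousFunction.mkOfCompact_apply, ContinuousMap.coe_mk] at h1
  -- Kernels are continuous and bounded, so weak convergence gives the integral against `F₀`; the
  -- same integrals tend to `ν y` because the error `1 - ν(A)` vanishes.
  refine tendsto_nhds_unique h1 (Tendsto.mono_left ?_ (Ultrafilter.of_le atTop))
  have hνy : ν y ≠ ⊤ := ne_top_of_le_ne_top (hν1 ▸ ENNReal.one_ne_top) (ENNReal.le_tsum y)
  have h2 : Tendsto (fun A : Finset S => ∫⁻ a, martinVec a y ∂(F A : Measure (MartinSpace p lam q)))
      atTop
      (𝓝 (ν y)) := by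
    have h3 : Tendsto (fun A : Finset S => ν y + (1 - ∑ z ∈ A, ν z)) atTop (𝓝 (ν y)) := by
      have hs : Tendsto (fun A : Finset S => ∑ z ∈ A, ν z) atTop (𝓝 1) :=
        hν1 ▸ ENNReal.summable.hasSum
      have h4 := tendsto_const_nhds (x := ν y) |>.add
        (ENNReal.Tendsto.sub tendsto_const_nhds hs (Or.inl ENNReal.one_ne_top))
      simpa using h4
    refine tendsto_of_tendsto_of_tendsto_of_le_of_le' tendsto_const_nhds h3 ?_ ?_
    · filter_upwards [eventually_ge_atTop {y}] with A hA
      exact (hF A y (hA (Finset.mem_singleton_self y))).1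
    · filter_upwards [eventually_ge_atTop {y}] with A hA
      exact (hF A y (hA (Finset.mem_singleton_self y))).2
  refine ((ENNReal.tendsto_toReal hνy).comp h2).congr fun A => ?_
  rw [Function.comp_apply, lintegral_martinVec, ENNReal.toReal_ofReal]
  exact integral_nonneg fun a => martinKernel_nonneg a y

lemma exists_measure_of_isQSD [Countable S] [Nonempty S]
    (hH : ∀ x, ∑' z, green p lam x z ≠ ⊤) {μ : S → ℝ} (hμ : IsQSD p lam μ) :
    ∃ F : Measure (MartinSpace p lam q), IsProbabilityMeasure F ∧
      F (qsdBoundary p lam q) = 1 ∧ ∀ y, μ y = ∫ a, martinKernel a y ∂F := by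
  obtain ⟨h0, h1, h2⟩ := (isQSD_iff_ofReal μ).1 hμ
  obtain ⟨F, hF⟩ := exists_measure_of_invariant (q := q) hH h2 h1
  have hrep : μ = fun y => ∫ a, martinKernel a y ∂(F : Measure (MartinSpace p lam q)) := by
    funext y
    rw [hF, ENNReal.toReal_ofReal (h0 y)]
  refine ⟨F, inferInstance, measure_qsdBoundary_eq_one hH _ ?_, congrFun hrep⟩
  rwa [← hrep]

end Representation

end QSD

end

theorem mainTheorem2 {S : Type*} [Countable S] [Infinite S]
    (p : Option S → PMF (Option S))
    (h_absorbing : p none = PMF.pure none)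
    (h_irreducible : QSD.IsIrreducibleOn p)
    (lam : ℝ) (h_finite : QSD.FiniteMGFRegime p lam)
    (q : S ≃ ℕ+) :
    CompactSpace (QSD.MartinSpace p lam q) ∧
    ((∃ μ : S → ℝ, QSD.IsQSD p lam μ) ↔ (QSD.qsdBoundary p lam q).Nonempty) ∧
    ((QSD.qsdBoundary p lam q).Nonempty →
      ∀ μ : S → ℝ, QSD.IsQSD p lam μ ↔
        ∃ F : MeasureTheory.Measure (QSD.MartinSpace p lam q),
          MeasureTheory.IsProbabilityMeasure F ∧
          F (QSD.qsdBoundary p lam q) = 1 ∧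
          ∀ y : S, μ y = ∫ a, QSD.martinKernel a y ∂F) := by
  have hH := QSD.tsum_green_ne_top p h_irreducible h_finite
  refine ⟨QSD.compactSpace_martinSpace, ⟨?_, ?_⟩, fun _ μ => ⟨QSD.exists_measure_of_isQSD hH, ?_⟩⟩
  · rintro ⟨μ, hμ⟩
    obtain ⟨F, -, hF, -⟩ := QSD.exists_measure_of_isQSD (q := q) hH hμ
    exact nonempty_of_measure_ne_zero (hF ▸ one_ne_zero)
  · rintro ⟨-, b, -, hb⟩
    exact ⟨_, hb⟩
  · rintro ⟨F, hFprob, hF, hμ⟩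
    rw [funext hμ]
    exact QSD.isQSD_of_integral hH F hF
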